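/- Let $(M,g)$ be a globally hyperbolic spacetime, i.e. a connected Hausdorff second countable smooth finite-dimensional manifold with a smooth Lorentzian metric $g$ of signature $(-,+,\dots,+)$, time oriented by a smooth timelike vector field, which is strongly causal and for which all sets $J^+(p)\cap J^-(q)$ are compact. Write $p\ll q$ if there is a piecewise smooth future directed timelike curve from $p$ to $q$, and put $I^+(A)=\{q: p\ll q \text{ for some } p\in A\}$ and $I^-(A)=\{q: q\ll p\text{ for some }p\in A\}$. Let $d(p,q)$ be the Lorentzian distance, i.e. the supremum of the lengths $\int\sqrt{-g(\dot c,\dot c)}\,dt$ of the piecewise smooth future directed causal curves $c$ from $p$ to $q$ ($d(p,q)=0$ if there is none). A $P$-motion is a map $\phi$ of $M$ onto itself with $d(\phi p,\phi q)=d(p,q)$ for all $p,q\in M$ and $p\ll\phi p$ for all $p\in M$. An axis of a $P$-motion $\phi$ is a future directed timelike geodesic $\gamma:J\to M$ on a non-empty open interval $J\subseteq\mathbb{R}$ (bounded or not) that is maximal, i.e. $d(\gamma(s),\gamma(t))$ equals the length of $\gamma|_{[s,t]}$ for all $s<t$ in $J$, and satisfies $\phi(\mathrm{Im}(\gamma))=\mathrm{Im}(\gamma)$.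 An axial motion is a $P$-motion that has an axis. Let $\phi$ be an axial motion on $(M,g)$ and let $\gamma$ be an axis of $\phi$. Then for every integer $l\ge 1$ and every $p\in\mathrm{Im}(\gamma)$, the number $d(p,\phi^l p)$ is finite and $$d(p,\phi^{l}p)=\sup_{q\in I^+(\gamma)\cap I^-(\gamma)}d(q,\phi^{l}q),$$ where $I^\pm(\gamma)=I^\pm(\mathrm{Im}(\gamma))$. -/

import Mathlib

open Set Topology
open scoped Manifold ContDiff ENNReal

noncomputable section

/-- A time-oriented Lorentzian structure on a smooth manifold `M` modelled on `E`: a smooth metric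
tensor of signature `(-,+,...,+)` together with a smooth timelike vector field. -/
structure Spacetime (E : Type*) [NormedAddCommGroup E] [NormedSpace ℝ E]
    (M : Type*) [TopologicalSpace M] [ChartedSpace E M] [IsManifold 𝓘(ℝ, E) ∞ M] where
  /-- the metric tensor -/
  g : ∀ p : M, TangentSpace 𝓘(ℝ, E) p →L[ℝ] TangentSpace 𝓘(ℝ, E) p →L[ℝ] ℝ
  g_symm : ∀ (p : M) (v w : TangentSpace 𝓘(ℝ, E) p), g p v w = g p w v
  /-- signature `(-,+,...,+)`: some vector is negative, and `g` is positive definite on its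
  orthogonal complement -/
  g_signature : ∀ p : M, ∃ v : TangentSpace 𝓘(ℝ, E) p, g p v v < 0 ∧
    ∀ w : TangentSpace 𝓘(ℝ, E) p, g p v w = 0 → w ≠ 0 → 0 < g p w w
  g_smooth : ContMDiff 𝓘(ℝ, E) (𝓘(ℝ, E).prod 𝓘(ℝ, E →L[ℝ] E →L[ℝ] ℝ)) ∞
    (fun p : M => Bundle.TotalSpace.mk' (E →L[ℝ] E →L[ℝ] ℝ)
      (E := fun p : M => TangentSpace 𝓘(ℝ, E) p →L[ℝ] TangentSpace 𝓘(ℝ, E) p →L[ℝ] ℝ) p (g p))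
  /-- the time orientation -/
  X : ∀ p : M, TangentSpace 𝓘(ℝ, E) p
  X_smooth : ContMDiff 𝓘(ℝ, E) 𝓘(ℝ, E).tangent ∞
    (fun p : M => (⟨p, X p⟩ : TangentBundle 𝓘(ℝ, E) M))
  X_timelike : ∀ p : M, g p (X p) (X p) < 0

namespace Spacetime

variable {E : Type*} [NormedAddCommGroup E] [NormedSpace ℝ E]
  {M : Type*} [TopologicalSpace M] [ChartedSpace E M] [IsManifold 𝓘(ℝ, E) ∞ M]

/-- Future directed causal tangent vectors. -/
def IsFutureCausal (S : Spacetime E M) {p : M} (v : TangentSpace 𝓘(ℝ, E) p) : Prop :=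
  v ≠ 0 ∧ S.g p v v ≤ 0 ∧ S.g p (S.X p) v < 0

/-- Future directed timelike tangent vectors. -/
def IsFutureTimelike (S : Spacetime E M) {p : M} (v : TangentSpace 𝓘(ℝ, E) p) : Prop :=
  S.g p v v < 0 ∧ S.g p (S.X p) v < 0

/-- The tangent vector at time `t` of a curve defined on `s` (one-sided at an endpoint of an
interval `s`). -/
def velocity (E : Type*) [NormedAddCommGroup E] [NormedSpace ℝ E]
    {M : Type*} [TopologicalSpace M] [ChartedSpace E M]
    (γ : ℝ → M) (s : Set ℝ) (t : ℝ) : TangentSpace 𝓘(ℝ, E) (γ t) :=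
  mfderivWithin 𝓘(ℝ, ℝ) 𝓘(ℝ, E) γ s t (1 : ℝ)

/-- `γ` restricted to `[τ 0, τ n]` is a continuous, piecewise smooth, future directed causal curve,
smooth on each piece `[τ i, τ (i + 1)]` of the partition `τ 0 < τ 1 < ... < τ n`. As consecutive
pieces share an endpoint, continuity on `[τ 0, τ n]` is automatic. -/
def IsCausalCurve (S : Spacetime E M) (γ : ℝ → M) (n : ℕ) (τ : ℕ → ℝ) : Prop :=
  0 < n ∧ ∀ i < n, τ i < τ (i + 1) ∧
    ContMDiffOn 𝓘(ℝ, ℝ) 𝓘(ℝ, E) ∞ γ (Icc (τ i) (τ (i + 1))) ∧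
    ∀ t ∈ Icc (τ i) (τ (i + 1)), S.IsFutureCausal (velocity E γ (Icc (τ i) (τ (i + 1))) t)

/-- As `IsCausalCurve`, with timelike tangent vectors. -/
def IsTimelikeCurve (S : Spacetime E M) (γ : ℝ → M) (n : ℕ) (τ : ℕ → ℝ) : Prop :=
  0 < n ∧ ∀ i < n, τ i < τ (i + 1) ∧
    ContMDiffOn 𝓘(ℝ, ℝ) 𝓘(ℝ, E) ∞ γ (Icc (τ i) (τ (i + 1))) ∧
    ∀ t ∈ Icc (τ i) (τ (i + 1)), S.IsFutureTimelike (velocity E γ (Icc (τ i) (τ (i + 1))) t)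

/-- `p ≪ q`. -/
def Chron (S : Spacetime E M) (p q : M) : Prop :=
  ∃ (γ : ℝ → M) (n : ℕ) (τ : ℕ → ℝ), S.IsTimelikeCurve γ n τ ∧ γ (τ 0) = p ∧ γ (τ n) = q

/-- `p ≤ q`. -/
def Causal (S : Spacetime E M) (p q : M) : Prop :=
  p = q ∨
    ∃ (γ : ℝ → M) (n : ℕ) (τ : ℕ → ℝ), S.IsCausalCurve γ n τ ∧ γ (τ 0) = p ∧ γ (τ n) = q

/-- The chronological future `I⁺(A)` of a set `A`. -/
def chronFuture (S : Spacetime E M) (A : Set M) : Set M := {q | ∃ p ∈ A, S.Chron p q}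

/-- The chronological past `I⁻(A)` of a set `A`. -/
def chronPast (S : Spacetime E M) (A : Set M) : Set M := {q | ∃ p ∈ A, S.Chron q p}

/-- The Lorentzian arclength over `[a, b]` of a curve that is smooth on `[a, b]`. -/
def arclength (S : Spacetime E M) (γ : ℝ → M) (a b : ℝ) : ℝ :=
  ∫ t in a..b, Real.sqrt (-(S.g (γ t) (velocity E γ (Icc a b) t) (velocity E γ (Icc a b) t)))

/-- The Lorentzian distance, with values in `[0, ∞]`: the supremum of the arclengths of the
piecewise smooth future directed causal curves from `p` to `q`. If there is no such curve, it is
the supremum of the empty set, that is, `0`. -/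
def dist (S : Spacetime E M) (p q : M) : ℝ≥0∞ :=
  ⨆ (γ : ℝ → M) (n : ℕ) (τ : ℕ → ℝ)
    (_ : S.IsCausalCurve γ n τ ∧ γ (τ 0) = p ∧ γ (τ n) = q),
    ENNReal.ofReal (∑ i ∈ Finset.range n, S.arclength γ (τ i) (τ (i + 1)))

/-- Strong causality: every point has arbitrarily small open neighbourhoods `V` that are causally
convex, i.e. no causal curve leaves `V` and comes back to it. -/
def IsStronglyCausal (S : Spacetime E M) : Prop :=
  ∀ p : M, ∀ U ∈ 𝓝 p, ∃ V ⊆ U, IsOpen V ∧ p ∈ V ∧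
    ∀ x ∈ V, ∀ y ∈ V, ∀ z, S.Causal x z → S.Causal z y → z ∈ V

/-- Global hyperbolicity: strong causality, and compactness of all `J⁺(p) ∩ J⁻(q)`. -/
def IsGloballyHyperbolic (S : Spacetime E M) : Prop :=
  S.IsStronglyCausal ∧ ∀ p q : M, IsCompact {z | S.Causal p z ∧ S.Causal z q}

/-- The components `g_y(u, v)` of the metric in the preferred chart at `c`, at the point of `M`
with coordinate `y`. -/
def chartMetric (S : Spacetime E M) (c : M) (y u v : E) : ℝ :=
  S.g ((extChartAt 𝓘(ℝ, E) c).symm y)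
    (mfderiv 𝓘(ℝ, E) 𝓘(ℝ, E) (extChartAt 𝓘(ℝ, E) c).symm y u)
    (mfderiv 𝓘(ℝ, E) 𝓘(ℝ, E) (extChartAt 𝓘(ℝ, E) c).symm y v)

/-- The geodesic equation at time `t`, in the chart at `γ t`, with the index lowered:
`g_x(x'', v) + Γ_x(x', x'; v) = 0` for all `v`, where `x` is the coordinate expression of `γ` and
`Γ_x(u, u; v) = (∂_u g)(u, v) - (∂_v g)(u, u) / 2` are the Christoffel symbols of the
first kind. -/
def GeodesicEquationAt (S : Spacetime E M) (γ : ℝ → M) (t : ℝ) : Prop :=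
  let x : ℝ → E := fun s => extChartAt 𝓘(ℝ, E) (γ t) (γ s)
  let u : E := deriv x t
  ∀ v : E,
    S.chartMetric (γ t) (x t) (deriv (deriv x) t) v
      + fderiv ℝ (fun y => S.chartMetric (γ t) y u v) (x t) u
      - fderiv ℝ (fun y => S.chartMetric (γ t) y u u) (x t) v / 2 = 0

/-- `γ`, on the open interval `J` (bounded or not), is a future directed timelike geodesic. -/
structure IsTimelikeGeodesic (S : Spacetime E M) (γ : ℝ → M) (J : Set ℝ) : Prop where
  isOpen : IsOpen J
  ordConnected : J.OrdConnected
  nonempty : J.Nonempty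
  smooth : ContMDiffOn 𝓘(ℝ, ℝ) 𝓘(ℝ, E) ∞ γ J
  timelike : ∀ t ∈ J, S.IsFutureTimelike (velocity E γ J t)
  geodesic : ∀ t ∈ J, S.GeodesicEquationAt γ t

/-- A timelike geodesic is maximal if each of its segments realizes the Lorentzian distance between
its endpoints. -/
def IsMaximalTimelikeGeodesic (S : Spacetime E M) (γ : ℝ → M) (J : Set ℝ) : Prop :=
  S.IsTimelikeGeodesic γ J ∧
    ∀ s ∈ J, ∀ t ∈ J, s < t → S.dist (γ s) (γ t) = ENNReal.ofReal (S.arclength γ s t)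

/-- A motion: a map of `M` onto itself that preserves the Lorentzian distance. -/
def IsMotion (S : Spacetime E M) (φ : M → M) : Prop :=
  Function.Surjective φ ∧ ∀ p q : M, S.dist (φ p) (φ q) = S.dist p q

/-- A `P`-motion. -/
def IsPMotion (S : Spacetime E M) (φ : M → M) : Prop :=
  S.IsMotion φ ∧ ∀ p : M, S.Chron p (φ p)

/-- `γ`, defined on the open interval `J`, is an axis of the `P`-motion `φ`. -/
def IsAxis (S : Spacetime E M) (φ : M → M) (γ : ℝ → M) (J : Set ℝ) : Prop :=
  S.IsPMotion φ ∧ S.IsMaximalTimelikeGeodesic γ J ∧ φ '' (γ '' J) = γ '' J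

/-- An axial motion is a `P`-motion that has an axis. -/
def IsAxialMotion (S : Spacetime E M) (φ : M → M) : Prop :=
  ∃ (γ : ℝ → M) (J : Set ℝ), S.IsAxis φ γ J

end Spacetime

end

/-! Put ψ = φ^l. It preserves d, moves every point by a positive distance and maps Im γ into itself.
On a maximal geodesic the reverse triangle inequality is an equality between ordered points, so all
points of γ have the same displacement C (`dist_map_eq`), and C is finite. Now let a ≪ q ≪ b with a,
b on γ. Iterating the reverse triangle inequality off γ, and additivity on γ, gives for every N N
d(q, ψq) ≤ d(a, ψ^N q) ≤ d(a, ψ^N b) = d(a, b) + N C. The error d(a, b) is finite and independent of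
N, so letting N grow yields d(q, ψq) ≤ C (`dist_map_le`). The supremum is attained on γ itself,
because an open geodesic lies in its own chronological future and past. -/

namespace Spacetime

/-! ### Velocity, speed and arclength of curves -/

section Curves

variable {E : Type*} [NormedAddCommGroup E] [NormedSpace ℝ E]
  {M : Type*} [TopologicalSpace M] [ChartedSpace E M]

/-- The velocity of a smooth curve does not depend on the set of parameters it is restricted to. -/
theorem velocity_mono {γ : ℝ → M} {s u : Set ℝ} {t : ℝ}
    (hγ : ContMDiffOn 𝓘(ℝ, ℝ) 𝓘(ℝ, E) ∞ γ s) (hus : u ⊆ s) (ht : t ∈ u)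
    (hu : UniqueDiffOn ℝ u) : velocity E γ u t = velocity E γ s t := by
  have h : MDifferentiableWithinAt 𝓘(ℝ, ℝ) 𝓘(ℝ, E) γ s t :=
    (hγ t (hus ht)).mdifferentiableWithinAt (by simp)
  unfold velocity
  rw [h.mfderivWithin_mono (hu t ht).uniqueMDiffWithinAt hus]

theorem velocity_comp_add {γ : ℝ → M} {a b c t : ℝ} (hab : a < b)
    (hγ : ContMDiffOn 𝓘(ℝ, ℝ) 𝓘(ℝ, E) ∞ γ (Icc (a + c) (b + c))) (ht : t ∈ Icc a b) :
    velocity E (fun s => γ (s + c)) (Icc a b) t =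
      velocity E γ (Icc (a + c) (b + c)) (t + c) := by
  have hmaps : Icc a b ⊆ (fun s : ℝ => s + c) ⁻¹' Icc (a + c) (b + c) := fun s hs =>
    ⟨by simpa using hs.1, by simpa using hs.2⟩
  have h : MDifferentiableWithinAt 𝓘(ℝ, ℝ) 𝓘(ℝ, E) γ (Icc (a + c) (b + c)) (t + c) :=
    (hγ _ (hmaps ht)).mdifferentiableWithinAt (by simp)
  have hd : HasFDerivWithinAt (fun s : ℝ => s + c) (ContinuousLinearMap.id ℝ ℝ) (Icc a b) t :=
    (hasFDerivWithinAt_id t _).add_const c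
  have h2 := HasMFDerivWithinAt.comp (f := fun s : ℝ => s + c) t h.hasMFDerivWithinAt
    hd.hasMFDerivWithinAt hmaps
  have hu : UniqueMDiffWithinAt 𝓘(ℝ, ℝ) (Icc a b) t :=
    (uniqueDiffOn_Icc hab t ht).uniqueMDiffWithinAt
  have h3 := h2.mfderivWithin hu
  unfold velocity
  have h4 := congrArg (fun L : ℝ →L[ℝ] E => L 1) h3
  exact h4

theorem velocity_congr {γ γ' : ℝ → M} {s : Set ℝ} (h : EqOn γ γ' s) {t : ℝ} (ht : t ∈ s) :
    (velocity E γ s t : E) = velocity E γ' s t := by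
  have := mfderivWithin_congr_of_mem (I := 𝓘(ℝ, ℝ)) (I' := 𝓘(ℝ, E)) h ht
  exact congrArg (fun L : ℝ →L[ℝ] E => L 1) this

variable [IsManifold 𝓘(ℝ, E) ∞ M] (S : Spacetime E M)

/-- The Lorentzian speed of a curve. -/
noncomputable def speed (γ : ℝ → M) (s : Set ℝ) (t : ℝ) : ℝ :=
  Real.sqrt (-(S.g (γ t) (velocity E γ s t) (velocity E γ s t)))

variable {S}

theorem IsFutureTimelike.isFutureCausal {p : M} {v : TangentSpace 𝓘(ℝ, E) p}
    (h : S.IsFutureTimelike v) : S.IsFutureCausal v := by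
  refine ⟨?_, h.1.le, h.2⟩
  rintro rfl
  simpa using h.1

theorem IsTimelikeCurve.isCausalCurve {γ : ℝ → M} {n : ℕ} {τ : ℕ → ℝ}
    (h : S.IsTimelikeCurve γ n τ) : S.IsCausalCurve γ n τ :=
  ⟨h.1, fun i hi => ⟨(h.2 i hi).1, (h.2 i hi).2.1,
    fun t ht => ((h.2 i hi).2.2 t ht).isFutureCausal⟩⟩

/-- The two velocities live in tangent spaces at points that are only propositionally equal, so they
are compared in the model space `E`. -/
theorem speed_congr {γ γ' : ℝ → M} {s s' : Set ℝ} {t t' : ℝ} (h : γ t = γ' t')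
    (hv : (velocity E γ s t : E) = velocity E γ' s' t') : S.speed γ s t = S.speed γ' s' t' := by
  have key : ∀ (p q : M) (v w : E), p = q → v = w →
      Real.sqrt (-(S.g p v v)) = Real.sqrt (-(S.g q w w)) := by
    rintro p _ v _ rfl rfl; rfl
  exact key _ _ _ _ h hv

theorem isFutureCausal_congr {γ γ' : ℝ → M} {s s' : Set ℝ} {t t' : ℝ} (h : γ t = γ' t')
    (hv : (velocity E γ s t : E) = velocity E γ' s' t')
    (hc : S.IsFutureCausal (velocity E γ' s' t')) : S.IsFutureCausal (velocity E γ s t) := by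
  have key : ∀ (p q : M) (v w : E), p = q → v = w →
      S.IsFutureCausal (p := q) w → S.IsFutureCausal (p := p) v := by
    rintro p _ v _ rfl rfl h; exact h
  exact key _ _ _ _ h hv hc

theorem arclength_eq_integral_speed (γ : ℝ → M) (a b : ℝ) :
    S.arclength γ a b = ∫ t in a..b, S.speed γ (Icc a b) t := rfl

theorem arclength_nonneg (γ : ℝ → M) {a b : ℝ} (hab : a ≤ b) : 0 ≤ S.arclength γ a b :=
  intervalIntegral.integral_nonneg hab fun _ _ => Real.sqrt_nonneg _

theorem arclength_eq_of_subset {γ : ℝ → M} {s : Set ℝ} {a b : ℝ} (hab : a < b)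
    (hγ : ContMDiffOn 𝓘(ℝ, ℝ) 𝓘(ℝ, E) ∞ γ s) (hs : Icc a b ⊆ s) :
    S.arclength γ a b = ∫ t in a..b, S.speed γ s t := by
  rw [arclength_eq_integral_speed]
  refine intervalIntegral.integral_congr fun t ht => ?_
  rw [uIcc_of_le hab.le] at ht
  exact speed_congr rfl (velocity_mono hγ hs ht (uniqueDiffOn_Icc hab))

/-- The velocity is the tangent map of the curve applied to the unit section, hence continuous into
the tangent bundle, and the metric is a continuous section. This supplies the integrability behind
positivity and additivity of arclength. -/
theorem continuousOn_speed {γ : ℝ → M} {s : Set ℝ} (hs : UniqueDiffOn ℝ s)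
    (hγ : ContMDiffOn 𝓘(ℝ, ℝ) 𝓘(ℝ, E) ∞ γ s) : ContinuousOn (S.speed γ s) s := by
  have hv : ContinuousOn (fun t => (⟨γ t, velocity E γ s t⟩ : TangentBundle 𝓘(ℝ, E) M)) s := by
    have h1 := hγ.continuousOn_tangentMapWithin (by simp) hs.uniqueMDiffOn
    have h2 : Continuous (fun t : ℝ => (⟨t, (1 : ℝ)⟩ : TangentBundle 𝓘(ℝ, ℝ) ℝ)) :=
      (tangentBundleModelSpaceHomeomorph 𝓘(ℝ, ℝ)).symm.continuous.comp
        (continuous_id.prodMk continuous_const)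
    exact h1.comp h2.continuousOn fun t ht => ht
  have hg := S.g_smooth.continuous.comp_continuousOn hγ.continuousOn
  have h := ContinuousOn.clm_bundle_apply₂ (F₁ := E) (F₂ := E) (F₃ := ℝ)
    (E₁ := fun p : M => TangentSpace 𝓘(ℝ, E) p) (E₂ := fun p : M => TangentSpace 𝓘(ℝ, E) p)
    (E₃ := Bundle.Trivial M ℝ) hg hv hv
  have h' : ContinuousOn
      (fun t => S.g (γ t) (velocity E γ s t) (velocity E γ s t)) s := fun t ht =>
    ((FiberBundle.continuousWithinAt_totalSpace (F := ℝ) (E := Bundle.Trivial M ℝ) _).1 (h t ht)).2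
  exact Real.continuous_sqrt.comp_continuousOn h'.neg

theorem arclength_pos {γ : ℝ → M} {a b : ℝ} (hab : a < b)
    (hγ : ContMDiffOn 𝓘(ℝ, ℝ) 𝓘(ℝ, E) ∞ γ (Icc a b))
    (ht : ∀ t ∈ Icc a b, S.IsFutureTimelike (velocity E γ (Icc a b) t)) :
    0 < S.arclength γ a b := by
  rw [arclength_eq_integral_speed]
  refine intervalIntegral.intervalIntegral_pos_of_pos_on ?_ ?_ hab
  · apply ContinuousOn.intervalIntegrable
    rw [uIcc_of_le hab.le]
    exact continuousOn_speed (uniqueDiffOn_Icc hab) hγ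
  · intro t h
    exact Real.sqrt_pos.2 (neg_pos.2 (ht t (Ioo_subset_Icc_self h)).1)

theorem arclength_of_eqOn {γ γ' : ℝ → M} {a b c : ℝ} (hab : a < b)
    (hγ : ContMDiffOn 𝓘(ℝ, ℝ) 𝓘(ℝ, E) ∞ γ' (Icc (a + c) (b + c)))
    (h : EqOn γ (fun t => γ' (t + c)) (Icc a b)) :
    S.arclength γ a b = S.arclength γ' (a + c) (b + c) := by
  rw [arclength_eq_integral_speed, arclength_eq_integral_speed,
    ← intervalIntegral.integral_comp_add_right]
  refine intervalIntegral.integral_congr fun t ht => ?_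
  rw [uIcc_of_le hab.le] at ht
  exact speed_congr (h ht) ((velocity_congr h ht).trans (velocity_comp_add hab hγ ht))

theorem causal_piece_of_eqOn {γ γ' : ℝ → M} {a b c : ℝ} (hab : a < b)
    (hγ : ContMDiffOn 𝓘(ℝ, ℝ) 𝓘(ℝ, E) ∞ γ' (Icc (a + c) (b + c)))
    (hc : ∀ t ∈ Icc (a + c) (b + c),
      S.IsFutureCausal (velocity E γ' (Icc (a + c) (b + c)) t))
    (h : EqOn γ (fun t => γ' (t + c)) (Icc a b)) :
    ContMDiffOn 𝓘(ℝ, ℝ) 𝓘(ℝ, E) ∞ γ (Icc a b) ∧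
      ∀ t ∈ Icc a b, S.IsFutureCausal (velocity E γ (Icc a b) t) := by
  have hmaps : ∀ t ∈ Icc a b, t + c ∈ Icc (a + c) (b + c) := fun s hs =>
    ⟨by simpa using hs.1, by simpa using hs.2⟩
  refine ⟨?_, fun t ht => isFutureCausal_congr (h ht)
    ((velocity_congr h ht).trans (velocity_comp_add hab hγ ht)) (hc _ (hmaps t ht))⟩
  have hadd : ContMDiff 𝓘(ℝ, ℝ) 𝓘(ℝ, ℝ) ∞ (fun t : ℝ => t + c) :=
    (contDiff_id.add contDiff_const).contMDiff
  exact (hγ.comp hadd.contMDiffOn hmaps).congr h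

/-! ### Concatenation of causal curves -/

theorem IsCausalCurve.monotone {γ : ℝ → M} {n : ℕ} {τ : ℕ → ℝ} (h : S.IsCausalCurve γ n τ)
    {i j : ℕ} (hij : i ≤ j) (hj : j ≤ n) : τ i ≤ τ j := by
  induction j, hij using Nat.le_induction with
  | base => exact le_rfl
  | succ k _ ih => exact (ih (by omega)).trans (h.2 k (by omega)).1.le

/-- Concatenation of causal curves. -/
theorem IsCausalCurve.exists_concat {γ₁ γ₂ : ℝ → M} {n₁ n₂ : ℕ} {τ₁ τ₂ : ℕ → ℝ}
    (h₁ : S.IsCausalCurve γ₁ n₁ τ₁) (h₂ : S.IsCausalCurve γ₂ n₂ τ₂)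
    (h : γ₁ (τ₁ n₁) = γ₂ (τ₂ 0)) :
    ∃ (γ : ℝ → M) (τ : ℕ → ℝ), S.IsCausalCurve γ (n₁ + n₂) τ ∧ γ (τ 0) = γ₁ (τ₁ 0) ∧
      γ (τ (n₁ + n₂)) = γ₂ (τ₂ n₂) ∧
      ∑ i ∈ Finset.range (n₁ + n₂), S.arclength γ (τ i) (τ (i + 1)) =
        ∑ i ∈ Finset.range n₁, S.arclength γ₁ (τ₁ i) (τ₁ (i + 1)) +
          ∑ i ∈ Finset.range n₂, S.arclength γ₂ (τ₂ i) (τ₂ (i + 1)) := by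
  -- The shift `c` makes the second parameter interval begin where the first one ends.
  obtain ⟨c, hc⟩ : ∃ c, c = τ₂ 0 - τ₁ n₁ := ⟨_, rfl⟩
  let γ : ℝ → M := fun t => if t ≤ τ₁ n₁ then γ₁ t else γ₂ (t + c)
  let τ : ℕ → ℝ := fun i => if i ≤ n₁ then τ₁ i else τ₂ (i - n₁) - c
  have hτ₁ : ∀ i ≤ n₁, τ i = τ₁ i := fun i hi => if_pos hi
  have hτ₂ : ∀ i, τ (n₁ + i) = τ₂ i - c := by
    intro i
    rcases Nat.eq_zero_or_pos i with rfl | hi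
    · rw [Nat.add_zero, hτ₁ _ le_rfl, hc]; ring
    · have : ¬ n₁ + i ≤ n₁ := by omega
      simp only [τ, if_neg this, Nat.add_sub_cancel_left]
  have hγ₁ : ∀ t ≤ τ₁ n₁, γ t = γ₁ t := fun t ht => if_pos ht
  -- The junction time is included, since smoothness is required on closed pieces; there the two
  -- formulas agree by `h`.
  have hγ₂ : ∀ t, τ₁ n₁ ≤ t → γ t = γ₂ (t + c) := by
    intro t ht
    rcases ht.eq_or_lt with rfl | ht
    · rw [hγ₁ _ le_rfl, h, hc]; congr 1; ring
    · exact if_neg (not_le.2 ht)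
  have e₁ : ∀ i < n₁, EqOn γ (fun t => γ₁ (t + 0)) (Icc (τ₁ i) (τ₁ (i + 1))) := by
    intro i hi t ht
    simp only [add_zero]
    exact hγ₁ t (ht.2.trans (h₁.monotone (by omega) le_rfl))
  have e₂ : ∀ i < n₂, EqOn γ (fun t => γ₂ (t + c)) (Icc (τ₂ i - c) (τ₂ (i + 1) - c)) := by
    intro i hi t ht
    refine hγ₂ t (le_trans ?_ ht.1)
    have := h₂.monotone (Nat.zero_le i) hi.le
    linarith
  refine ⟨γ, τ, ⟨Nat.add_pos_left h₁.1 _, fun i hi => ?_⟩, ?_, ?_, ?_⟩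
  · rcases lt_or_ge i n₁ with hi₁ | hi₁
    · rw [hτ₁ i hi₁.le, hτ₁ (i + 1) hi₁]
      obtain ⟨hlt, hs, hv⟩ := h₁.2 i hi₁
      exact ⟨hlt, causal_piece_of_eqOn (c := 0) hlt (by simpa using hs)
        (by simpa using hv) (e₁ i hi₁)⟩
    · obtain ⟨j, rfl⟩ := Nat.exists_eq_add_of_le hi₁
      rw [add_assoc, hτ₂, hτ₂]
      obtain ⟨hlt, hs, hv⟩ := h₂.2 j (by omega)
      have hlt' : τ₂ j - c < τ₂ (j + 1) - c := by linarith
      exact ⟨hlt', causal_piece_of_eqOn (c := c) hlt' (by simpa using hs)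
        (by simpa using hv) (e₂ j (by omega))⟩
  · rw [hτ₁ 0 (Nat.zero_le _), hγ₁ _ (h₁.monotone (Nat.zero_le _) le_rfl)]
  · rw [hτ₂, hγ₂, sub_add_cancel]
    have := h₂.monotone (Nat.zero_le n₂) le_rfl
    linarith
  · rw [Finset.sum_range_add]
    congr 1
    · refine Finset.sum_congr rfl fun i hi => ?_
      have hi := Finset.mem_range.1 hi
      obtain ⟨hlt, hs, -⟩ := h₁.2 i hi
      rw [hτ₁ i hi.le, hτ₁ (i + 1) hi]
      simpa using arclength_of_eqOn (S := S) (c := 0) hlt (by simpa using hs) (e₁ i hi)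
    · refine Finset.sum_congr rfl fun i hi => ?_
      have hi := Finset.mem_range.1 hi
      obtain ⟨hlt, hs, -⟩ := h₂.2 i hi
      have hlt' : τ₂ i - c < τ₂ (i + 1) - c := by linarith
      rw [add_assoc, hτ₂, hτ₂]
      simpa using arclength_of_eqOn (S := S) (c := c) hlt' (by simpa using hs) (e₂ i hi)

/-! ### Lorentzian distance -/

theorem IsCausalCurve.sum_arclength_nonneg {γ : ℝ → M} {n : ℕ} {τ : ℕ → ℝ}
    (h : S.IsCausalCurve γ n τ) :
    0 ≤ ∑ i ∈ Finset.range n, S.arclength γ (τ i) (τ (i + 1)) :=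
  Finset.sum_nonneg fun i hi => arclength_nonneg γ (h.2 i (Finset.mem_range.1 hi)).1.le

theorem IsCausalCurve.le_dist {γ : ℝ → M} {n : ℕ} {τ : ℕ → ℝ} (h : S.IsCausalCurve γ n τ) :
    ENNReal.ofReal (∑ i ∈ Finset.range n, S.arclength γ (τ i) (τ (i + 1))) ≤
      S.dist (γ (τ 0)) (γ (τ n)) :=
  le_iSup_of_le γ <| le_iSup_of_le n <| le_iSup_of_le τ <| le_iSup_of_le ⟨h, rfl, rfl⟩ le_rfl

theorem exists_isCausalCurve_of_lt_dist {p q : M} {r : ℝ≥0∞} (h : r < S.dist p q) :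
    ∃ (γ : ℝ → M) (n : ℕ) (τ : ℕ → ℝ), S.IsCausalCurve γ n τ ∧ γ (τ 0) = p ∧ γ (τ n) = q ∧
      r < ENNReal.ofReal (∑ i ∈ Finset.range n, S.arclength γ (τ i) (τ (i + 1))) := by
  simp only [dist, lt_iSup_iff] at h
  obtain ⟨γ, n, τ, ⟨h₁, h₂, h₃⟩, h₄⟩ := h
  exact ⟨γ, n, τ, h₁, h₂, h₃, h₄⟩

/-- The reverse triangle inequality. -/
theorem dist_add_dist_le {x y z : M} (hxy : 0 < S.dist x y) (hyz : 0 < S.dist y z) :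
    S.dist x y + S.dist y z ≤ S.dist x z := by
  refine le_of_forall_lt fun r hr => ?_
  -- Positivity of both distances allows bounds strictly below each of them, which forces causal
  -- curves to exist on both sides.
  obtain ⟨a, ha, b, hb, hab⟩ := ENNReal.exists_lt_add_of_lt_add hr hxy.ne' hyz.ne'
  obtain ⟨γ₁, n₁, τ₁, h₁, rfl, hy, hl₁⟩ := exists_isCausalCurve_of_lt_dist ha
  obtain ⟨γ₂, n₂, τ₂, h₂, hy', rfl, hl₂⟩ := exists_isCausalCurve_of_lt_dist hb
  obtain ⟨γ, τ, h, h0, hn, hl⟩ := h₁.exists_concat h₂ (hy.trans hy'.symm)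
  have := h.le_dist
  rw [h0, hn, hl, ENNReal.ofReal_add h₁.sum_arclength_nonneg h₂.sum_arclength_nonneg] at this
  exact (hab.trans (ENNReal.add_lt_add hl₁ hl₂)).trans_le this

theorem Chron.dist_pos {p q : M} (h : S.Chron p q) : 0 < S.dist p q := by
  obtain ⟨γ, n, τ, h, rfl, rfl⟩ := h
  refine lt_of_lt_of_le (ENNReal.ofReal_pos.2 ?_) h.isCausalCurve.le_dist
  refine Finset.sum_pos (fun i hi => ?_) (Finset.nonempty_range_iff.2 h.1.ne')
  obtain ⟨h1, h2, h3⟩ := h.2 i (Finset.mem_range.1 hi)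
  exact arclength_pos h1 h2 h3

/-! ### Timelike geodesics -/

theorem IsTimelikeGeodesic.chron {γ : ℝ → M} {J : Set ℝ} (h : S.IsTimelikeGeodesic γ J)
    {s t : ℝ} (hs : s ∈ J) (ht : t ∈ J) (hst : s < t) : S.Chron (γ s) (γ t) := by
  have hJ : Icc s t ⊆ J := h.ordConnected.out hs ht
  refine ⟨γ, 1, fun i => if i = 0 then s else t, ⟨one_pos, fun i hi => ?_⟩, by simp, by simp⟩
  obtain rfl : i = 0 := by omega
  simp only [if_true, zero_add, one_ne_zero, if_false]
  refine ⟨hst, h.smooth.mono hJ, fun u hu => ?_⟩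
  rw [velocity_mono h.smooth hJ hu (uniqueDiffOn_Icc hst)]
  exact h.timelike u (hJ hu)

theorem IsTimelikeGeodesic.arclength_add {γ : ℝ → M} {J : Set ℝ} (h : S.IsTimelikeGeodesic γ J)
    {r s t : ℝ} (hr : r ∈ J) (ht : t ∈ J) (hrs : r < s) (hst : s < t) :
    S.arclength γ r s + S.arclength γ s t = S.arclength γ r t := by
  have hJ : Icc r t ⊆ J := h.ordConnected.out hr ht
  have h1 : Icc r s ⊆ J := (Icc_subset_Icc_right hst.le).trans hJ
  have h2 : Icc s t ⊆ J := (Icc_subset_Icc_left hrs.le).trans hJ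
  have hc := continuousOn_speed (S := S) h.isOpen.uniqueDiffOn h.smooth
  rw [arclength_eq_of_subset hrs h.smooth h1, arclength_eq_of_subset hst h.smooth h2,
    arclength_eq_of_subset (hrs.trans hst) h.smooth hJ]
  refine intervalIntegral.integral_add_adjacent_intervals ?_ ?_ <;>
    apply ContinuousOn.intervalIntegrable
  · rw [uIcc_of_le hrs.le]; exact hc.mono h1
  · rw [uIcc_of_le hst.le]; exact hc.mono h2

theorem IsTimelikeGeodesic.exists_lt {γ : ℝ → M} {J : Set ℝ} (h : S.IsTimelikeGeodesic γ J)
    {s : ℝ} (hs : s ∈ J) : ∃ r ∈ J, r < s := by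
  obtain ⟨r, hr, hrs⟩ := mem_nhdsLT_iff_exists_Ioo_subset.1
    (nhdsWithin_le_nhds (h.isOpen.mem_nhds hs))
  obtain ⟨u, hu⟩ := exists_between (mem_Iio.1 hr)
  exact ⟨u, hrs hu, hu.2⟩

theorem IsTimelikeGeodesic.exists_gt {γ : ℝ → M} {J : Set ℝ} (h : S.IsTimelikeGeodesic γ J)
    {s : ℝ} (hs : s ∈ J) : ∃ r ∈ J, s < r := by
  obtain ⟨r, hr, hrs⟩ := mem_nhdsGT_iff_exists_Ioo_subset.1
    (nhdsWithin_le_nhds (h.isOpen.mem_nhds hs))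
  obtain ⟨u, hu⟩ := exists_between (mem_Ioi.1 hr)
  exact ⟨u, hrs hu, hu.1⟩

theorem dist_iterate_iterate {ψ : M → M} (hψ : ∀ x y, S.dist (ψ x) (ψ y) = S.dist x y) (n : ℕ)
    (x y : M) : S.dist (ψ^[n] x) (ψ^[n] y) = S.dist x y := by
  induction n with
  | zero => rfl
  | succ n ih => rwa [Function.iterate_succ_apply', Function.iterate_succ_apply', hψ]

/-! ### Distance and displacement along a maximal geodesic -/

namespace IsMaximalTimelikeGeodesic

variable {γ : ℝ → M} {J : Set ℝ} (h : S.IsMaximalTimelikeGeodesic γ J)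
include h

/-- A positive value could be added to the finite distance from an earlier point `γ r` to `γ s`,
which would then exceed itself. -/
theorem dist_self_eq_zero {s : ℝ} (hs : s ∈ J) : S.dist (γ s) (γ s) = 0 := by
  by_contra hne
  have hpos := pos_iff_ne_zero.2 hne
  obtain ⟨r, hr, hrs⟩ := h.1.exists_lt hs
  have h1 := dist_add_dist_le (h.1.chron hr hs hrs).dist_pos hpos
  have hfin : S.dist (γ r) (γ s) ≠ ⊤ := by
    rw [h.2 r hr s hs hrs]; exact ENNReal.ofReal_ne_top
  exact (ENNReal.lt_add_right hfin hne).not_ge h1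

/-- Otherwise `γ s` is `γ t` or later, and returning to it along `γ` would make its distance to
itself positive. Thus positive distance recovers the parameter order on `γ`. -/
theorem lt_of_dist_pos {s t : ℝ} (hs : s ∈ J) (ht : t ∈ J) (hpos : 0 < S.dist (γ s) (γ t)) :
    s < t := by
  by_contra! hts
  rcases hts.eq_or_lt with rfl | hts
  · exact hpos.ne' (h.dist_self_eq_zero hs)
  · have h1 := dist_add_dist_le hpos (h.1.chron ht hs hts).dist_pos
    rw [h.dist_self_eq_zero hs] at h1
    exact hpos.ne' (add_eq_zero.1 (le_zero_iff.1 h1)).1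

theorem dist_ne_top {x y : M} (hx : x ∈ γ '' J) (hy : y ∈ γ '' J) : S.dist x y ≠ ⊤ := by
  obtain ⟨s, hs, rfl⟩ := hx
  obtain ⟨t, ht, rfl⟩ := hy
  rcases eq_zero_or_pos (S.dist (γ s) (γ t)) with h0 | hpos
  · simp [h0]
  · rw [h.2 s hs t ht (h.lt_of_dist_pos hs ht hpos)]
    exact ENNReal.ofReal_ne_top

theorem dist_add_dist {x y z : M} (hx : x ∈ γ '' J) (hy : y ∈ γ '' J) (hz : z ∈ γ '' J)
    (hxy : 0 < S.dist x y) (hyz : 0 < S.dist y z) :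
    S.dist x y + S.dist y z = S.dist x z := by
  obtain ⟨r, hr, rfl⟩ := hx
  obtain ⟨s, hs, rfl⟩ := hy
  obtain ⟨t, ht, rfl⟩ := hz
  have hrs := h.lt_of_dist_pos hr hs hxy
  have hst := h.lt_of_dist_pos hs ht hyz
  rw [h.2 r hr s hs hrs, h.2 s hs t ht hst, h.2 r hr t ht (hrs.trans hst),
    ← ENNReal.ofReal_add (arclength_nonneg γ hrs.le) (arclength_nonneg γ hst.le),
    h.1.arclength_add hr ht hrs hst]

variable {ψ : M → M} (hψ : ∀ x y, S.dist (ψ x) (ψ y) = S.dist x y)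
  (hpos : ∀ x, 0 < S.dist x (ψ x)) (hmaps : MapsTo ψ (γ '' J) (γ '' J))
include hψ hpos hmaps

/-- The displacement of a distance preserving map is constant along an invariant geodesic. -/
theorem dist_map_eq {x y : M} (hx : x ∈ γ '' J) (hy : y ∈ γ '' J) :
    S.dist x (ψ x) = S.dist y (ψ y) := by
  have key : ∀ {x y : M}, x ∈ γ '' J → y ∈ γ '' J → 0 < S.dist x y →
      S.dist x (ψ x) = S.dist y (ψ y) := by
    intro x y hx hy hxy
    -- Compute d(x, ψy) through y and through ψx, then cancel the finite d(x, y) = d(ψx, ψy).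
    have h1 := h.dist_add_dist hx hy (hmaps hy) hxy (hpos y)
    have h2 := h.dist_add_dist hx (hmaps hx) (hmaps hy) (hpos x) (by rwa [hψ])
    rw [hψ, ← h1, add_comm (S.dist x y)] at h2
    exact (ENNReal.add_left_inj (h.dist_ne_top hx hy)).1 h2
  have hx' := hx
  have hy' := hy
  obtain ⟨s, hs, rfl⟩ := hx'
  obtain ⟨t, ht, rfl⟩ := hy'
  rcases lt_trichotomy s t with hst | rfl | hst
  · exact key hx hy (h.1.chron hs ht hst).dist_pos
  · rfl
  · exact (key hy hx (h.1.chron ht hs hst).dist_pos).symm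

theorem dist_iterate {a b : M} (ha : a ∈ γ '' J) (hb : b ∈ γ '' J) (hab : 0 < S.dist a b)
    (N : ℕ) : S.dist a (ψ^[N] b) = S.dist a b + N * S.dist b (ψ b) := by
  have hmem : ∀ n, ψ^[n] b ∈ γ '' J := fun n => hmaps.iterate n hb
  induction N with
  | zero => simp
  | succ N ih =>
    have hN : 0 < S.dist a (ψ^[N] b) := by rw [ih]; exact hab.trans_le le_self_add
    have hstep := h.dist_add_dist ha (hmem N) (hmaps (hmem N)) hN (hpos _)
    rw [Function.iterate_succ_apply', ← hstep, ih,
      h.dist_map_eq hψ hpos hmaps (hmem N) hb]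
    push_cast
    ring

/-- A distance preserving map displaces points between two points of an invariant maximal geodesic
no more than points of the geodesic. -/
theorem dist_map_le {a b p q : M} (ha : a ∈ γ '' J) (hb : b ∈ γ '' J) (hp : p ∈ γ '' J)
    (haq : 0 < S.dist a q) (hqb : 0 < S.dist q b) :
    S.dist q (ψ q) ≤ S.dist p (ψ p) := by
  -- Follow the orbit of q: each step from ψ^N q to ψ^(N+1) q has the same length d(q, ψq). The
  -- initial d(a, q) > 0 keeps the distances positive, as the reverse triangle inequality needs.
  have hlow : ∀ N : ℕ, S.dist a q + N * S.dist q (ψ q) ≤ S.dist a (ψ^[N] q) := by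
    intro N
    induction N with
    | zero => simp
    | succ N ih =>
      have hN : 0 < S.dist a (ψ^[N] q) := (haq.trans_le le_self_add).trans_le ih
      have hstep := dist_add_dist_le hN (hpos (ψ^[N] q))
      have hq : S.dist (ψ^[N] q) (ψ (ψ^[N] q)) = S.dist q (ψ q) := by
        rw [← Function.iterate_succ_apply' ψ N q, Function.iterate_succ_apply,
          dist_iterate_iterate hψ]
      rw [Function.iterate_succ_apply']
      refine le_trans ?_ hstep
      rw [hq]
      push_cast
      rw [add_mul, one_mul, ← add_assoc]
      gcongr
  have hab : 0 < S.dist a b := (haq.trans_le le_self_add).trans_le (dist_add_dist_le haq hqb)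
  have hle : ∀ N : ℕ, N * S.dist q (ψ q) ≤ S.dist a b + N * S.dist p (ψ p) := by
    intro N
    rw [h.dist_map_eq hψ hpos hmaps hp hb, ← h.dist_iterate hψ hpos hmaps ha hb hab]
    have hN : 0 < S.dist a (ψ^[N] q) := (haq.trans_le le_self_add).trans_le (hlow N)
    calc (N : ℝ≥0∞) * S.dist q (ψ q) ≤ S.dist a q + N * S.dist q (ψ q) := le_add_self
      _ ≤ S.dist a (ψ^[N] q) := hlow N
      _ ≤ S.dist a (ψ^[N] q) + S.dist (ψ^[N] q) (ψ^[N] b) := le_self_add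
      _ ≤ S.dist a (ψ^[N] b) := dist_add_dist_le hN (by rwa [dist_iterate_iterate hψ])
  have hA : S.dist a b ≠ ⊤ := h.dist_ne_top ha hb
  have hC : S.dist p (ψ p) ≠ ⊤ := h.dist_ne_top hp (hmaps hp)
  -- The case N = 1 already bounds the displacement of q by a finite number.
  have hD : S.dist q (ψ q) ≠ ⊤ := by
    have := (hle 1).trans_lt (ENNReal.add_lt_top.2 ⟨hA.lt_top, by simpa using hC.lt_top⟩)
    simpa using this.ne
  lift S.dist a b to NNReal using hA with A
  lift S.dist p (ψ p) to NNReal using hC with C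
  lift S.dist q (ψ q) to NNReal using hD with D
  by_contra! hlt
  have hlt : (C : ℝ) < D := by exact_mod_cast hlt
  -- If C < D, this N gives N (D - C) > A, against `hle N`.
  obtain ⟨N, hN⟩ := exists_nat_gt ((A : ℝ) / (D - C))
  rw [div_lt_iff₀ (by linarith)] at hN
  have h2 : (N : ℝ) * D ≤ A + N * C := by exact_mod_cast hle N
  linarith

end IsMaximalTimelikeGeodesic

theorem IsPMotion.dist_iterate_pos {φ : M → M} (h : S.IsPMotion φ) {n : ℕ} (hn : 1 ≤ n) (x : M) :
    0 < S.dist x (φ^[n] x) := by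
  induction n, hn using Nat.le_induction with
  | base => exact (h.2 x).dist_pos
  | succ n _ ih =>
    rw [Function.iterate_succ_apply']
    exact (ih.trans_le le_self_add).trans_le (dist_add_dist_le ih (h.2 _).dist_pos)

end Curves

end Spacetime

theorem mainTheorem11 {E : Type*} [NormedAddCommGroup E] [NormedSpace ℝ E] [FiniteDimensional ℝ E]
    {M : Type*} [TopologicalSpace M] [T2Space M] [SecondCountableTopology M] [ConnectedSpace M]
    [ChartedSpace E M] [IsManifold 𝓘(ℝ, E) ∞ M]
    (S : Spacetime E M) (hS : S.IsGloballyHyperbolic)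
    (φ : M → M) (hφ : S.IsAxialMotion φ)
    (γ : ℝ → M) (J : Set ℝ) (hγ : S.IsAxis φ γ J)
    (l : ℕ) (hl : 1 ≤ l) (p : M) (hp : p ∈ γ '' J) :
    S.dist p (φ^[l] p) < ⊤ ∧
      S.dist p (φ^[l] p) =
        ⨆ q ∈ S.chronFuture (γ '' J) ∩ S.chronPast (γ '' J), S.dist q (φ^[l] q) := by
  obtain ⟨hP, hmax, himg⟩ := hγ
  have hmaps : MapsTo φ^[l] (γ '' J) (γ '' J) :=
    MapsTo.iterate (fun x hx => himg ▸ mem_image_of_mem φ hx) l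
  refine ⟨(hmax.dist_ne_top hp (hmaps hp)).lt_top, le_antisymm ?_ ?_⟩
  · refine le_iSup₂_of_le p ?_ le_rfl
    -- As `J` is open, `γ` has points before and after p, so p itself competes in the supremum.
    obtain ⟨s, hs, rfl⟩ := hp
    obtain ⟨r, hr, hrs⟩ := hmax.1.exists_lt hs
    obtain ⟨t, ht, hst⟩ := hmax.1.exists_gt hs
    exact ⟨⟨γ r, mem_image_of_mem γ hr, hmax.1.chron hr hs hrs⟩,
      ⟨γ t, mem_image_of_mem γ ht, hmax.1.chron hs ht hst⟩⟩
  · refine iSup₂_le fun q hq => ?_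
    obtain ⟨⟨a, ha, haq⟩, ⟨b, hb, hqb⟩⟩ := hq
    exact hmax.dist_map_le (Spacetime.dist_iterate_iterate hP.1.2 l) (hP.dist_iterate_pos hl) hmaps
      ha hb hp haq.dist_pos hqb.dist_pos
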